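/- Let $d,n\in\mathbb{N}$, let $\mathbb{T}^d=\mathbb{R}^d/\mathbb{Z}^d$, let $\omega\in\mathbb{R}^d$, and let $A:\mathbb{T}^d\to gl(n,\mathbb{C})$ be of class $C^\infty$. Let $X_{\omega,A}$ be the associated quasi-periodic cocycle, i.e. the solution of $\frac{d}{dt}X^t_{\omega,A}(\theta)=A(\theta+t\omega)X^t_{\omega,A}(\theta)$, $X^0_{\omega,A}(\theta)=I$. Write $\partial_\omega Z(\theta)=\frac{d}{dt}Z(\theta+t\omega)|_{t=0}$ and $\|F\|_{C^r}=\max_{|\alpha|\le r}\sup_{\theta}\|\partial^\alpha F(\theta)\|$, with the operator norm on matrices. We say that $X_{\omega,A}$ is *almost reducible to the sequence* $(B_j)_{j\in\mathbb{N}}$ in $gl(n,\mathbb{C})$ if there are sequences of $C^\infty$ maps $Z_j:\mathbb{T}^d\to GL(n,\mathbb{C})$ and $F_j:\mathbb{T}^d\to gl(n,\mathbb{C})$ such that $$\partial_\omega Z_j(\theta)=A(\theta)Z_j(\theta)-Z_j(\theta)\big(B_j+F_j(\theta)\big)\qquad\forall j\in\mathbb{N},\ \forall\theta\in\mathbb{T}^d,$$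 and, for all $r,m\in\mathbb{N}$, $$\lim_{j\to+\infty}\|Z_j\|_{C^r}^m\,\|F_j\|_{C^r}=0\quad\text{and}\quad \lim_{j\to+\infty}\|Z_j^{-1}\|_{C^r}^m\,\|F_j\|_{C^r}=0 .$$ We say that $X_{\omega,A}$ is *almost reducible* if it is almost reducible to some sequence $(B_j)$ in $gl(n,\mathbb{C})$. The vector $\omega$ is *Diophantine* if there are $\kappa>0$ and $\tau>d-1$ with $|\langle k,\omega\rangle|\ge \kappa/|k|^{\tau}$ for all $k\in\mathbb{Z}^d\setminus\{0\}$, where $|k|=\sum_i|k_i|$. **Proposition.** If $X_{\omega,A}$ is almost reducible and $\omega$ is Diophantine, then $X_{\omega,A}$ is almost reducible to a sequence $(\tilde B_j)_{j\in\mathbb{N}}$ of matrices, each of which is in Jordan normal form, i.e. block diagonal with diagonal blocks that are (upper) Jordan blocks, with $1$'s on the superdiagonal. -/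

import Mathlib

open scoped Matrix.Norms.L2Operator

noncomputable section

namespace QPCocycle

/-- The canonical projection `ℝ^d → 𝕋^d = ℝ^d / ℤ^d`. -/
def proj {d : ℕ} (x : Fin d → ℝ) : UnitAddTorus (Fin d) :=
  fun i => ((x i : ℝ) : UnitAddCircle)

/-- The `ℤ^d`-periodic function on `ℝ^d` associated with a function on the torus `𝕋^d`. -/
def lift {d : ℕ} {E : Type*} (f : UnitAddTorus (Fin d) → E) : (Fin d → ℝ) → E :=
  fun x => f (proj x)

/-- A function on the torus is `C^∞` if its periodic lift is. -/
def Smooth {d : ℕ} {E : Type*} [NormedAddCommGroup E] [NormedSpace ℝ E]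
    (f : UnitAddTorus (Fin d) → E) : Prop :=
  ContDiff ℝ ((⊤ : ℕ∞) : WithTop ℕ∞) (lift f)

/-- The partial derivative `∂f/∂x_i` of a function on `ℝ^d`. -/
def partialDeriv {d : ℕ} {E : Type*} [NormedAddCommGroup E] [NormedSpace ℝ E]
    (i : Fin d) (f : (Fin d → ℝ) → E) : (Fin d → ℝ) → E :=
  fun x => fderiv ℝ f x (Pi.single i 1)

/-- The derivative `∂^α f = ∂_1^{α_1} ⋯ ∂_d^{α_d} f` for a multi-index `α ∈ ℕ^d`. -/
def multiDeriv {d : ℕ} {E : Type*} [NormedAddCommGroup E] [NormedSpace ℝ E]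
    (α : Fin d → ℕ) (f : (Fin d → ℝ) → E) : (Fin d → ℝ) → E :=
  (List.finRange d).foldr (fun i g => (partialDeriv i)^[α i] g) f

/-- The norm `‖f‖_{C^r} = max_{|α| ≤ r} sup_θ ‖∂^α f(θ)‖` of a smooth function on the torus.
(For a smooth function on the torus the set below is nonempty and bounded.) -/
def crNorm {d : ℕ} {E : Type*} [NormedAddCommGroup E] [NormedSpace ℝ E]
    (r : ℕ) (f : UnitAddTorus (Fin d) → E) : ℝ :=
  sSup {c : ℝ | ∃ α : Fin d → ℕ, ∑ i, α i ≤ r ∧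
    ∃ x : Fin d → ℝ, c = ‖multiDeriv α (lift f) x‖}

/-- The derivative in the direction `ω`:
`∂_ω f(θ) = d/dt f(θ + t ω)` at `t = 0`. -/
def dirDeriv {d : ℕ} {E : Type*} [NormedAddCommGroup E] [NormedSpace ℝ E]
    (ω : Fin d → ℝ) (f : UnitAddTorus (Fin d) → E) (θ : UnitAddTorus (Fin d)) : E :=
  deriv (fun t : ℝ => f (θ + proj (t • ω))) 0

/-- `ω` is Diophantine: for some `κ > 0` and `τ > d - 1`,
`|⟨k, ω⟩| ≥ κ / |k|^τ` for all nonzero `k ∈ ℤ^d`, where `|k|` is the `ℓ¹` norm. -/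
def Diophantine {d : ℕ} (ω : Fin d → ℝ) : Prop :=
  ∃ κ τ : ℝ, 0 < κ ∧ (d : ℝ) - 1 < τ ∧
    ∀ k : Fin d → ℤ, k ≠ 0 →
      κ / (∑ i, |(k i : ℝ)|) ^ τ ≤ |∑ i, (k i : ℝ) * ω i|

/-- The cocycle `X_{ω,A}` is almost reducible to the sequence of constant matrices `B_j`:
there are smooth `Z_j : 𝕋^d → GL(n,ℂ)` and smooth `F_j : 𝕋^d → gl(n,ℂ)` with
`∂_ω Z_j = A Z_j - Z_j (B_j + F_j)` and, for all `r, m ∈ ℕ`,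
`‖Z_j‖_{C^r}^m ‖F_j‖_{C^r} → 0` and `‖Z_j⁻¹‖_{C^r}^m ‖F_j‖_{C^r} → 0`. -/
def AlmostReducibleTo {d n : ℕ} (ω : Fin d → ℝ)
    (A : UnitAddTorus (Fin d) → Matrix (Fin n) (Fin n) ℂ)
    (B : ℕ → Matrix (Fin n) (Fin n) ℂ) : Prop :=
  ∃ (Z : ℕ → UnitAddTorus (Fin d) → GL (Fin n) ℂ)
    (F : ℕ → UnitAddTorus (Fin d) → Matrix (Fin n) (Fin n) ℂ),
    (∀ j, Smooth (fun θ => (Z j θ).val)) ∧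
    (∀ j, Smooth (F j)) ∧
    (∀ j θ, dirDeriv ω (fun θ' => (Z j θ').val) θ
      = A θ * (Z j θ).val - (Z j θ).val * (B j + F j θ)) ∧
    (∀ r m : ℕ,
      Filter.Tendsto (fun j => crNorm r (fun θ => (Z j θ).val) ^ m * crNorm r (F j))
        Filter.atTop (nhds 0) ∧
      Filter.Tendsto (fun j => crNorm r (fun θ => ((Z j θ)⁻¹).val) ^ m * crNorm r (F j))
        Filter.atTop (nhds 0))

/-- The cocycle `X_{ω,A}` is almost reducible: it is almost reducible to some sequence of
constant matrices. -/
def AlmostReducible {d n : ℕ} (ω : Fin d → ℝ)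
    (A : UnitAddTorus (Fin d) → Matrix (Fin n) (Fin n) ℂ) : Prop :=
  ∃ B : ℕ → Matrix (Fin n) (Fin n) ℂ, AlmostReducibleTo ω A B

/-- The Jordan block of size `s` with eigenvalue `z`: `z` on the diagonal, `1` on the
superdiagonal and `0` elsewhere. -/
def jordanBlock (s : ℕ) (z : ℂ) : Matrix (Fin s) (Fin s) ℂ :=
  Matrix.of fun i j =>
    if i = j then z else if (i : ℕ) + 1 = (j : ℕ) then 1 else 0

/-- A matrix is in Jordan normal form if it is block diagonal, with consecutive diagonal blocks
that are Jordan blocks. -/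
def IsJordanNormalForm {n : ℕ} (B : Matrix (Fin n) (Fin n) ℂ) : Prop :=
  ∃ (l : ℕ) (s : Fin l → ℕ) (h : ∑ k, s k = n) (z : Fin l → ℂ),
    B = Matrix.reindex (finSigmaFinEquiv.trans (finCongr h))
      (finSigmaFinEquiv.trans (finCongr h))
      (Matrix.blockDiagonal' fun k => jordanBlock (s k) (z k))

end QPCocycle

end

/-! Conjugating `B j` to its exact Jordan form by `P` would replace `Z j` by `Z j * P`, but `P` and
its inverse are uncontrolled near matrices where the Jordan structure jumps. Nearby eigenvalues and
small nilpotent parts must be collapsed, and the resulting error `E` has to be tiny even against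
high powers of the norms of `P` and its inverse. `exists_quantitative_jordan` provides this: for a
bound `R` on the entries, these norms are at most `R ^ k` and the error is at most `R ^ (-k * m)`,
with `k` bounded in terms of the size and `m` only.

That lemma is proved by compactness. A family of counterexamples with unbounded `k` is one matrix
over the ring of sequences of at most polynomial growth in `R` along an ultrafilter. Modulo
sequences smaller than all negative powers of `R`, this ring becomes an algebraically closed field,
where the Jordan form exists exactly. Lifting it back gives polynomially bounded conjugations with
negligible error, which refutes the counterexamples far enough out (`exists_moderate_jordan`).

For the cocycle, `R` is the size of all the data: the `C^r` norms of `Z j` and its inverse, and the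
norm of `B j`, which the conjugation equation bounds. By `tendsto_size_pow_mul` the remainder beats
every power of this size. Letting `r` and `m` grow slowly with `j` yields one sequence of
conjugations that works for all `r` and `m`. The new remainder `P⁻¹ (F + E) P` is then smaller than
any fixed power of the new conjugations and their inverses. -/

namespace QPCocycle

/-! ### Jordan normal form over an algebraically closed field. -/

open Polynomial Module

/-- The Jordan block over an arbitrary commutative ring. -/
def jordanBlockOver {R : Type*} [CommRing R] (s : ℕ) (z : R) : Matrix (Fin s) (Fin s) R :=
  Matrix.of fun i j => if i = j then z else if (i : ℕ) + 1 = (j : ℕ) then 1 else 0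

/-- The block diagonal matrix with the Jordan blocks of sizes `s k` and eigenvalues `z k`. -/
noncomputable def jordanMatrix {R : Type*} [CommRing R] {n l : ℕ} (s : Fin l → ℕ)
    (h : ∑ k, s k = n) (z : Fin l → R) : Matrix (Fin n) (Fin n) R :=
  Matrix.reindex (finSigmaFinEquiv.trans (finCongr h)) (finSigmaFinEquiv.trans (finCongr h))
    (Matrix.blockDiagonal' fun k => jordanBlockOver (s k) (z k))

theorem isJordanNormalForm_jordanMatrix {n l : ℕ} (s : Fin l → ℕ) (h : ∑ k, s k = n)
    (z : Fin l → ℂ) : IsJordanNormalForm (jordanMatrix s h z) :=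
  ⟨l, s, h, z, rfl⟩

section Cyclic

variable {K : Type*} [Field K] (a : K) (e : ℕ)

/-- The element `(X - a)^(e-1-i)` of `K[X] / (X - a)^e`. -/
noncomputable def cyclicVec (i : Fin e) : K[X] ⧸ K[X] ∙ (X - C a) ^ e :=
  Submodule.Quotient.mk ((X - C a) ^ (e - 1 - (i : ℕ)))

/-- Write `X = a + (X - a)`: the factor `X - a` raises the exponent by one, hence lowers the index,
and kills index `0` since `(X - a) ^ e = 0`. Decreasing exponents are what put the ones above the
diagonal. -/
theorem X_smul_cyclicVec (i : Fin e) :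
    (X : K[X]) • cyclicVec a e i = a • cyclicVec a e i +
      if h : 0 < (i : ℕ) then cyclicVec a e ⟨i - 1, by omega⟩ else 0 := by
  have ha : a • cyclicVec a e i =
      Submodule.Quotient.mk (C a * (X - C a) ^ (e - 1 - (i : ℕ))) := by
    rw [← smul_eq_C_mul]; rfl
  rw [ha, cyclicVec, ← Submodule.Quotient.mk_smul, smul_eq_mul]
  split_ifs with h
  · rw [cyclicVec, ← Submodule.Quotient.mk_add]
    congr 1
    have : e - 1 - (i - 1 : ℕ) = (e - 1 - i) + 1 := by omega
    simp only [this]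
    ring
  · rw [add_zero, Submodule.Quotient.eq, Submodule.mem_span_singleton]
    refine ⟨1, ?_⟩
    have : e = (e - 1 - i) + 1 := by omega
    conv_lhs => rw [this]
    simp only [smul_eq_mul]
    ring

/-- Taylor expansion at `a`: terms of degree at least `e` vanish in the quotient, the others are
multiples of the vectors. -/
theorem span_cyclicVec : ⊤ ≤ Submodule.span K (Set.range (cyclicVec a e)) := by
  intro x _
  obtain ⟨p, rfl⟩ := Submodule.Quotient.mk_surjective _ x
  rw [← sum_taylor_eq p a, Polynomial.sum_def, ← Submodule.mkQ_apply, map_sum]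
  refine Submodule.sum_mem _ fun i _ => ?_
  rw [← smul_eq_C_mul]
  by_cases hi : i < e
  · have : (Submodule.mkQ _) ((taylor a p).coeff i • (X - C a) ^ i) =
        (taylor a p).coeff i • cyclicVec a e ⟨e - 1 - i, by omega⟩ := by
      have h : e - 1 - (e - 1 - i) = i := by omega
      simp only [cyclicVec, h]
      rfl
    rw [this]
    exact Submodule.smul_mem _ _ (Submodule.subset_span ⟨_, rfl⟩)
  · have : (Submodule.mkQ (K[X] ∙ (X - C a) ^ e)) ((taylor a p).coeff i • (X - C a) ^ i) = 0 := by
      rw [Submodule.mkQ_apply, Submodule.Quotient.mk_eq_zero, Submodule.mem_span_singleton]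
      refine ⟨C ((taylor a p).coeff i) * (X - C a) ^ (i - e), ?_⟩
      rw [smul_eq_mul, mul_assoc, ← pow_add, Nat.sub_add_cancel (not_lt.mp hi), smul_eq_C_mul]
    rw [this]
    exact Submodule.zero_mem _

theorem linearIndependent_cyclicVec : LinearIndependent K (cyclicVec a e) := by
  refine linearIndependent_of_top_le_span_of_card_eq_finrank (span_cyclicVec a e) ?_
  have h := finrank_quotient_span_eq_natDegree (K := K) (f := (X - C a) ^ e)
  rw [natDegree_pow, natDegree_X_sub_C, mul_one] at h
  rw [Fintype.card_fin]
  exact h.symm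

/-- The Jordan basis of `K[X] / (X - a)^e`. -/
noncomputable def cyclicBasis : Basis (Fin e) K (K[X] ⧸ K[X] ∙ (X - C a) ^ e) :=
  Basis.mk (linearIndependent_cyclicVec a e) (span_cyclicVec a e)

end Cyclic

/-- View `V` as a torsion `K[X]`-module with `X` acting by `φ`. The structure theorem splits it into
cyclic primary summands, and over an algebraically closed field each irreducible is associated to
some `X - C a`. -/
theorem exists_jordan_basis_sigma {K : Type} [Field K] [IsAlgClosed K] {V : Type} [AddCommGroup V]
    [Module K V] [Module.Finite K V] (φ : V →ₗ[K] V) :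
    ∃ (ι : Type) (_ : Fintype ι) (s : ι → ℕ) (z : ι → K) (b : Basis (Σ k, Fin (s k)) K V),
      ∀ k i, φ (b ⟨k, i⟩) = z k • b ⟨k, i⟩ +
        if h : 0 < (i : ℕ) then b ⟨k, ⟨i - 1, by omega⟩⟩ else 0 := by
  classical
  have htors : Module.IsTorsion K[X] (AEval' φ) := AEval.isTorsion_of_finiteDimensional K V φ
  obtain ⟨ι, _, p, hp, s, ⟨E⟩⟩ := Module.equiv_directSum_of_isTorsion htors
  have hlin : ∀ i, ∃ a : K, K[X] ∙ p i ^ s i = K[X] ∙ (X - C a) ^ s i := by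
    intro i
    obtain ⟨a, ha⟩ := IsAlgClosed.exists_root (p i) (degree_pos_of_irreducible (hp i)).ne'
    refine ⟨a, Ideal.span_singleton_eq_span_singleton.mpr (Associated.pow_pow ?_)⟩
    exact ((irreducible_X_sub_C a).associated_of_dvd (hp i) (dvd_iff_isRoot.mpr ha)).symm
  choose z hz using hlin
  let E' : AEval' φ ≃ₗ[K[X]] DirectSum ι fun i => K[X] ⧸ K[X] ∙ (X - C (z i)) ^ s i :=
    E.trans (DFinsupp.mapRange.linearEquiv fun i => Submodule.quotEquivOfEq _ _ (hz i))
  let b₀ : Basis (Σ k, Fin (s k)) K (DirectSum ι fun i => K[X] ⧸ K[X] ∙ (X - C (z i)) ^ s i) :=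
    DFinsupp.basis fun i => cyclicBasis (z i) (s i)
  have hb₀ : ∀ k i, b₀ ⟨k, i⟩ = DirectSum.lof K[X] ι _ k (cyclicVec (z k) (s k) i) := by
    intro k i
    refine b₀.repr.injective ?_
    rw [Basis.repr_self]
    ext ⟨k', i'⟩
    change _ = (cyclicBasis (z k') (s k')).repr
      ((DirectSum.lof K[X] ι (fun i => K[X] ⧸ K[X] ∙ (X - C (z i)) ^ s i) k
        (cyclicVec (z k) (s k) i)) k') i'
    by_cases hk : k = k'
    · subst hk
      rw [DirectSum.lof_apply]
      rw [show cyclicVec (z k) (s k) i = cyclicBasis (z k) (s k) i by simp [cyclicBasis]]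
      rw [Basis.repr_self, Finsupp.single_apply, Finsupp.single_apply]
      simp
    · rw [DirectSum.lof_eq_of, DirectSum.of_eq_of_ne _ _ _ (Ne.symm hk), Finsupp.single_apply,
        if_neg (fun h => hk (congrArg Sigma.fst h))]
      simp
  let b := b₀.map ((E'.restrictScalars K).symm.trans (AEval.of K V φ).symm)
  refine ⟨ι, inferInstance, s, z, b, fun k i => ?_⟩
  have hb : ∀ c, b c = (AEval.of K V φ).symm (E'.symm (b₀ c)) := fun c => rfl
  have h1 := AEval.of_symm_X_smul φ (E'.symm (b₀ ⟨k, i⟩))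
  rw [← hb, ← map_smul, hb₀, ← map_smul, X_smul_cyclicVec] at h1
  rw [← Module.End.smul_def, ← h1, map_add, map_add, map_add]
  congr 1
  · have hC : z k • cyclicVec (z k) (s k) i = (C (z k) : K[X]) • cyclicVec (z k) (s k) i :=
      (algebraMap_smul K[X] (z k) _).symm
    rw [hb, hb₀, hC, map_smul, map_smul, AEval.C_smul, map_smul]
  · split_ifs with h
    · rw [hb, hb₀]
    · simp

theorem exists_jordan_basis {K : Type} [Field K] [IsAlgClosed K] {V : Type} [AddCommGroup V]
    [Module K V] [Module.Finite K V] (φ : V →ₗ[K] V) :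
    ∃ (l : ℕ) (s : Fin l → ℕ) (z : Fin l → K) (b : Basis (Σ k, Fin (s k)) K V),
      LinearMap.toMatrix b b φ = Matrix.blockDiagonal' fun k => jordanBlockOver (s k) (z k) := by
  classical
  obtain ⟨ι, _, s, z, b, hb⟩ := exists_jordan_basis_sigma φ
  let σ := (Fintype.equivFin ι).symm
  let b' : Basis (Σ k, Fin (s (σ k))) K V := b.reindex (Equiv.sigmaCongrLeft (β := fun k => Fin (s k)) σ).symm
  refine ⟨_, fun k => s (σ k), fun k => z (σ k), b', ?_⟩
  have hb' : ∀ k i, b' ⟨k, i⟩ = b ⟨σ k, i⟩ := fun k i => by simp [b', Equiv.sigmaCongrLeft]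
  ext ⟨k, i⟩ ⟨k', j⟩
  rw [LinearMap.toMatrix_apply, hb', hb, ← hb', map_add, map_smul, Basis.repr_self,
    Matrix.blockDiagonal'_apply]
  have key : b'.repr (if h : 0 < (j : ℕ) then b ⟨σ k', ⟨j - 1, (Nat.sub_le _ _).trans_lt j.2⟩⟩ else 0) ⟨k, i⟩
      = if k = k' ∧ (i : ℕ) + 1 = j then 1 else 0 := by
    split_ifs with h h' h'
    · obtain ⟨rfl, h'⟩ := h'
      rw [← hb' k, Basis.repr_self, Finsupp.single_apply, if_pos]
      congr 1
      ext
      simp only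
      omega
    · rw [← hb' k', Basis.repr_self, Finsupp.single_apply, if_neg]
      intro heq
      obtain ⟨rfl, heq⟩ := Sigma.mk.inj_iff.mp heq
      have := congrArg Fin.val (eq_of_heq heq)
      exact h' ⟨rfl, by simp only at this; omega⟩
    · omega
    · simp
  rw [Finsupp.add_apply, key, Finsupp.smul_apply, Finsupp.single_apply]
  by_cases hk : k = k'
  · subst hk
    by_cases hij : i = j
    · subst hij
      simp [jordanBlockOver]
    · simp [jordanBlockOver, hij, Ne.symm hij]
  · simp [hk, Ne.symm hk]

/-- **Jordan normal form** over an algebraically closed field. -/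
theorem exists_jordanMatrix_similar {K : Type} [Field K] [IsAlgClosed K] {n : ℕ}
    (M : Matrix (Fin n) (Fin n) K) :
    ∃ (l : ℕ) (s : Fin l → ℕ) (h : ∑ k, s k = n) (z : Fin l → K)
      (P Q : Matrix (Fin n) (Fin n) K), P * Q = 1 ∧ M = P * jordanMatrix s h z * Q := by
  obtain ⟨l, s, z, b, hb⟩ := exists_jordan_basis (Matrix.toLin' M)
  have h : ∑ k, s k = n := by
    have h1 := Module.finrank_eq_card_basis b
    simpa using h1.symm
  let b' := b.reindex (finSigmaFinEquiv.trans (finCongr h))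
  have hJ : LinearMap.toMatrix b' b' (Matrix.toLin' M) = jordanMatrix s h z := by
    rw [jordanMatrix, ← hb]
    ext i j
    simp only [LinearMap.toMatrix_apply, b', Basis.repr_reindex_apply, Basis.reindex_apply,
      Matrix.reindex_apply, Matrix.submatrix_apply]
  refine ⟨l, s, h, z, (Pi.basisFun K (Fin n)).toMatrix b', b'.toMatrix (Pi.basisFun K (Fin n)),
    ?_, ?_⟩
  · simp
  · rw [← hJ, basis_toMatrix_mul_linearMap_toMatrix_mul_basis_toMatrix]
    rw [LinearMap.toMatrix_eq_toMatrix', LinearMap.toMatrix'_toLin']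

end QPCocycle

/-! ### The field of moderate sequences modulo negligible ones. -/

namespace QPCocycle

open Polynomial Filter

section Residue

variable (U : Ultrafilter ℕ) (R : ℕ → ℝ) (hR : ∀ j, 2 ≤ R j)

include hR in
theorem pow_pos_of_two_le (j k : ℕ) : 0 < R j ^ k :=
  pow_pos (by linarith [hR j]) k

/-- The ring of sequences that are bounded, along the ultrafilter `U`, by a power of `R`. -/
def moderate : Subring (ℕ → ℂ) where
  carrier := {x | ∃ k : ℕ, ∀ᶠ j in (U : Filter ℕ), ‖x j‖ ≤ R j ^ k}
  mul_mem' := by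
    rintro x y ⟨k, hk⟩ ⟨l, hl⟩
    refine ⟨k + l, ?_⟩
    filter_upwards [hk, hl] with j h1 h2
    rw [Pi.mul_apply, norm_mul, pow_add]
    exact mul_le_mul h1 h2 (norm_nonneg _) ((norm_nonneg _).trans h1)
  one_mem' := ⟨0, by simp⟩
  add_mem' := by
    rintro x y ⟨k, hk⟩ ⟨l, hl⟩
    refine ⟨max k l + 1, ?_⟩
    filter_upwards [hk, hl] with j h1 h2
    have h3 : R j ^ k ≤ R j ^ max k l :=
      pow_le_pow_right₀ (by linarith [hR j]) (le_max_left _ _)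
    have h4 : R j ^ l ≤ R j ^ max k l :=
      pow_le_pow_right₀ (by linarith [hR j]) (le_max_right _ _)
    have h5 := pow_pos_of_two_le R hR j (max k l)
    have h6 := norm_add_le (x j) (y j)
    rw [Pi.add_apply, pow_succ]
    nlinarith [hR j]
  zero_mem' := ⟨0, by simp⟩
  neg_mem' := by
    rintro x ⟨k, hk⟩
    exact ⟨k, by simpa using hk⟩

/-- The ideal of sequences that are smaller, along `U`, than every negative power of `R`. -/
def negligible : Ideal (moderate U R hR) where
  carrier := {x | ∀ k : ℕ, ∀ᶠ j in (U : Filter ℕ), ‖x.1 j‖ * R j ^ k ≤ 1}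
  add_mem' := by
    intro x y hx hy k
    filter_upwards [hx (k + 1), hy (k + 1)] with j h1 h2
    have h5 := pow_pos_of_two_le R hR j k
    have h6 : ‖(x + y).1 j‖ ≤ ‖x.1 j‖ + ‖y.1 j‖ := norm_add_le (x.1 j) (y.1 j)
    rw [pow_succ] at h1 h2
    have h7 := mul_nonneg (mul_nonneg (norm_nonneg (x.1 j)) h5.le) (sub_nonneg.mpr (hR j))
    have h8 := mul_nonneg (mul_nonneg (norm_nonneg (y.1 j)) h5.le) (sub_nonneg.mpr (hR j))
    have h9 := mul_le_mul_of_nonneg_right h6 h5.le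
    nlinarith
  zero_mem' := fun k => by simp
  smul_mem' := by
    rintro ⟨a, l, hl⟩ x hx k
    filter_upwards [hl, hx (l + k)] with j h1 h2
    have h3 : (‖((⟨a, l, hl⟩ : moderate U R hR) • x).1 j‖) = ‖a j‖ * ‖x.1 j‖ := norm_mul _ _
    rw [h3]
    calc ‖a j‖ * ‖x.1 j‖ * R j ^ k ≤ R j ^ l * ‖x.1 j‖ * R j ^ k := by
          have := (pow_pos_of_two_le R hR j k).le
          gcongr
      _ = ‖x.1 j‖ * R j ^ (l + k) := by ring
      _ ≤ 1 := h2

theorem mem_negligible_of_eventually_eq_zero {x : moderate U R hR}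
    (h : ∀ᶠ j in (U : Filter ℕ), x.1 j = 0) : x ∈ negligible U R hR := by
  intro k
  filter_upwards [h] with j hj
  simp [hj]

/-- By the ultrafilter dichotomy, a sequence that is not negligible exceeds some fixed `R ^ (-k)` in
norm along `U`; its termwise inverse is then moderate. -/
instance negligible_isMaximal : (negligible U R hR).IsMaximal := by
  rw [Ideal.isMaximal_iff]
  constructor
  · intro h
    obtain ⟨j, hj⟩ := (h 1).exists
    have : ‖(1 : moderate U R hR).1 j‖ = 1 := norm_one
    rw [this, one_mul, pow_one] at hj
    linarith [hR j]
  · intro J x hIJ hx hxJ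
    have : ∃ k : ℕ, ∀ᶠ j in (U : Filter ℕ), 1 < ‖x.1 j‖ * R j ^ k := by
      by_contra! h
      exact hx h
    obtain ⟨k, hk⟩ := this
    let y : moderate U R hR := ⟨fun j => (x.1 j)⁻¹, k, by
      filter_upwards [hk] with j hj
      rw [norm_inv]
      have h0 : 0 < ‖x.1 j‖ := by
        by_contra h
        have : ‖x.1 j‖ = 0 := le_antisymm (not_lt.mp h) (norm_nonneg _)
        rw [this] at hj
        linarith
      rw [inv_le_iff_one_le_mul₀' h0]
      exact hj.le⟩
    have h1 : y * x - 1 ∈ negligible U R hR := by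
      apply mem_negligible_of_eventually_eq_zero
      filter_upwards [hk] with j hj
      have h0 : x.1 j ≠ 0 := by
        intro h
        rw [h, norm_zero] at hj
        linarith
      change (x.1 j)⁻¹ * x.1 j - 1 = 0
      rw [inv_mul_cancel₀ h0, sub_self]
    have h2 := J.sub_mem (J.mul_mem_left y hxJ) (hIJ h1)
    simpa using h2

/-- The residue field of moderate sequences modulo negligible ones. -/
abbrev Residue : Type := moderate U R hR ⧸ negligible U R hR

noncomputable instance : Field (Residue U R hR) := Ideal.Quotient.field _

theorem mem_moderate_of_le {x y : ℕ → ℂ} (hy : y ∈ moderate U R hR) (h : ∀ j, ‖x j‖ ≤ ‖y j‖) :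
    x ∈ moderate U R hR := by
  obtain ⟨k, hk⟩ := hy
  exact ⟨k, hk.mono fun j hj => (h j).trans hj⟩

/-- The `j`-th term of a moderate sequence. -/
def evalAt (j : ℕ) : moderate U R hR →+* ℂ := (Pi.evalRingHom (fun _ => ℂ) j).comp (Subring.subtype _)

/-- Lift a monic irreducible polynomial to a monic one over moderate sequences and choose a complex
root of each term. Cauchy's bound controls these roots by the coefficients, so the sequence of roots
is itself moderate. -/
instance : IsAlgClosed (Residue U R hR) := by
  refine IsAlgClosed.of_exists_root _ fun p hp hirr => ?_
  have hlift : p ∈ Polynomial.lifts (Ideal.Quotient.mk (negligible U R hR)) := by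
    rw [Polynomial.mem_lifts]
    exact Polynomial.map_surjective _ Ideal.Quotient.mk_surjective p
  obtain ⟨q, hq, hdeg, hmon⟩ := Polynomial.lifts_and_natDegree_eq_and_monic hlift hp
  have hroot : ∀ j, ∃ x : ℂ, (q.map (evalAt U R hR j)).IsRoot x := by
    intro j
    apply IsAlgClosed.exists_root
    rw [Polynomial.degree_eq_natDegree (hmon.map _).ne_zero, hmon.natDegree_map, hdeg]
    have := natDegree_pos_iff_degree_pos.mpr (degree_pos_of_irreducible hirr)
    exact_mod_cast this.ne'
  choose x hx using hroot
  have hxm : x ∈ moderate U R hR := by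
    have hc : ∀ i, (fun j => (‖(q.coeff i).1 j‖ : ℂ)) ∈ moderate U R hR := fun i =>
      mem_moderate_of_le U R hR (q.coeff i).2 fun j => by simp
    refine mem_moderate_of_le U R hR
      (add_mem (sum_mem fun i (_ : i ∈ Finset.range q.natDegree) => hc i) (one_mem _)) fun j => ?_
    have h1 := (hx j).norm_lt_cauchyBound (hmon.map _).ne_zero
    rw [cauchyBound, (hmon.map _).leadingCoeff, nnnorm_one, div_one, hmon.natDegree_map] at h1
    have h3 : (Finset.range q.natDegree).sup
        (fun i => ‖(q.map (evalAt U R hR j)).coeff i‖₊) ≤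
        ∑ i ∈ Finset.range q.natDegree, ‖(q.coeff i).1 j‖₊ := by
      refine Finset.sup_le fun i hi => ?_
      rw [Polynomial.coeff_map]
      exact Finset.single_le_sum (f := fun i => ‖(q.coeff i).1 j‖₊) (fun _ _ => zero_le) hi
    have h4 : ‖x j‖ ≤ ∑ i ∈ Finset.range q.natDegree, ‖(q.coeff i).1 j‖ + 1 := by
      have := (h1.le.trans (add_le_add_left h3 1))
      have := NNReal.coe_le_coe.mpr this
      push_cast at this
      simpa using this
    refine h4.trans (le_of_eq ?_)
    rw [Pi.add_apply, Finset.sum_apply, Pi.one_apply, ← Complex.ofReal_sum, ← Complex.ofReal_one,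
      ← Complex.ofReal_add, Complex.norm_real, Real.norm_of_nonneg]
    positivity
  refine ⟨Ideal.Quotient.mk _ ⟨x, hxm⟩, ?_⟩
  rw [← hq, Polynomial.eval_map, Polynomial.eval₂_at_apply]
  have : q.eval ⟨x, hxm⟩ = 0 := by
    ext j
    have h := hx j
    rw [IsRoot, Polynomial.eval_map] at h
    have h2 := Polynomial.hom_eval₂ q (RingHom.id _) (evalAt U R hR j) ⟨x, hxm⟩
    exact h2.trans h
  rw [this, map_zero]

theorem exists_norm_le_of_entry_le (n : ℕ) : ∃ C : ℝ, 0 ≤ C ∧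
    ∀ (M : Matrix (Fin n) (Fin n) ℂ) (b : ℝ), (∀ i j, ‖M i j‖ ≤ b) → ‖M‖ ≤ C * b := by
  refine ⟨∑ i : Fin n, ∑ j : Fin n, ‖Matrix.single i j (1 : ℂ)‖, by positivity, fun M b h => ?_⟩
  conv_lhs => rw [Matrix.matrix_eq_sum_single M]
  rw [Finset.sum_mul]
  refine (norm_sum_le _ _).trans (Finset.sum_le_sum fun i _ => ?_)
  rw [Finset.sum_mul]
  refine (norm_sum_le _ _).trans (Finset.sum_le_sum fun j _ => ?_)
  have : Matrix.single i j (M i j) = M i j • Matrix.single i j (1 : ℂ) := by simp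
  rw [this, norm_smul, mul_comm]
  exact mul_le_mul_of_nonneg_left (h i j) (norm_nonneg _)

theorem eventually_norm_le_of_moderate {n : ℕ} (M : Matrix (Fin n) (Fin n) (moderate U R hR)) :
    ∃ k : ℕ, ∀ᶠ j in (U : Filter ℕ), ‖M.map (evalAt U R hR j)‖ ≤ R j ^ k := by
  obtain ⟨C, hC, hM⟩ := exists_norm_le_of_entry_le n
  have hsum : (fun j => ((C : ℂ) * ∑ i, ∑ i', (‖(M i i').1 j‖ : ℂ))) ∈ moderate U R hR := by
    have h1 : ∀ i i', (fun j => (‖(M i i').1 j‖ : ℂ)) ∈ moderate U R hR := fun i i' =>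
      mem_moderate_of_le U R hR (M i i').2 fun j => by simp
    have h2 : (fun _ => (C : ℂ)) ∈ moderate U R hR := by
      -- As `2 ≤ R j`, any constant is absorbed into a fixed power of `R j`.
      obtain ⟨c, hc⟩ := pow_unbounded_of_one_lt C (one_lt_two)
      refine ⟨c, Eventually.of_forall fun j => ?_⟩
      rw [Complex.norm_real, Real.norm_of_nonneg hC]
      exact hc.le.trans (pow_le_pow_left₀ (by norm_num) (hR j) c)
    have h3 := mul_mem h2 (sum_mem fun i (_ : i ∈ Finset.univ) =>
      sum_mem fun i' (_ : i' ∈ Finset.univ) => h1 i i')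
    convert h3 using 1
    ext j
    simp
  obtain ⟨k, hk⟩ := hsum
  refine ⟨k, hk.mono fun j hj => (hM _ (∑ i, ∑ i', ‖(M i i').1 j‖) fun i i' => ?_).trans (le_trans (le_of_eq ?_) hj)⟩
  · have h1 := Finset.single_le_sum (f := fun i' => ‖(M i i').1 j‖)
      (fun _ _ => norm_nonneg _) (Finset.mem_univ i')
    have h2 := Finset.single_le_sum (f := fun i => ∑ i', ‖(M i i').1 j‖)
      (fun _ _ => by positivity) (Finset.mem_univ i)
    exact h1.trans h2
  · simp only [← Complex.ofReal_sum, ← Complex.ofReal_mul]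
    rw [Complex.norm_real, Real.norm_of_nonneg (by positivity)]

theorem eventually_norm_le_of_negligible {n : ℕ} (M : Matrix (Fin n) (Fin n) (moderate U R hR))
    (h : ∀ i i', M i i' ∈ negligible U R hR) (m : ℕ) :
    ∀ᶠ j in (U : Filter ℕ), ‖M.map (evalAt U R hR j)‖ * R j ^ m ≤ 1 := by
  obtain ⟨C, hC, hM⟩ := exists_norm_le_of_entry_le n
  obtain ⟨c, hc⟩ := pow_unbounded_of_one_lt C (one_lt_two)
  have : ∀ᶠ j in (U : Filter ℕ), ∀ i i', ‖(M i i').1 j‖ * R j ^ (c + m) ≤ 1 :=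
    eventually_all.mpr fun i => eventually_all.mpr fun i' => h i i' (c + m)
  refine this.mono fun j hj => ?_
  have hp := pow_pos_of_two_le R hR j
  have h1 := hM (M.map (evalAt U R hR j)) (1 / R j ^ (c + m)) fun i i' => by
    rw [le_div_iff₀ (hp _)]
    exact hj i i'
  have h2 : C ≤ R j ^ c := hc.le.trans (pow_le_pow_left₀ (by norm_num) (hR j) c)
  calc ‖M.map (evalAt U R hR j)‖ * R j ^ m ≤ R j ^ c * (1 / R j ^ (c + m)) * R j ^ m := by
        have := (hp m).le
        have := (hp (c + m)).le
        refine mul_le_mul_of_nonneg_right (h1.trans ?_) (by assumption)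
        exact mul_le_mul_of_nonneg_right h2 (by positivity)
    _ = 1 := by
        have := (hp c).ne'
        have := (hp m).ne'
        rw [pow_add]
        field_simp

theorem jordanMatrix_map {S T : Type*} [CommRing S] [CommRing T] (f : S →+* T) {n l : ℕ}
    (s : Fin l → ℕ) (h : ∑ k, s k = n) (z : Fin l → S) :
    (jordanMatrix s h z).map f = jordanMatrix s h (fun k => f (z k)) := by
  ext i j
  simp only [jordanMatrix, Matrix.map_apply, Matrix.reindex_apply, Matrix.submatrix_apply,
    Matrix.blockDiagonal'_apply, jordanBlockOver]
  split_ifs with h1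
  · simp only [Matrix.of_apply]
    split_ifs <;> simp
  · simp

theorem map_smul_one {S T : Type*} [CommRing S] [CommRing T] (f : S →+* T) {n : ℕ} (c : S) :
    (c • (1 : Matrix (Fin n) (Fin n) S)).map f = f c • (1 : Matrix (Fin n) (Fin n) T) := by
  ext i j
  simp only [Matrix.map_apply, Matrix.smul_apply, smul_eq_mul, map_mul, Matrix.one_apply]
  split_ifs <;> simp

/-- A unit modulo negligible sequences has a moderate inverse along the ultrafilter. -/
theorem exists_eventual_inverse (u : moderate U R hR)
    (hu : Ideal.Quotient.mk (negligible U R hR) u = 1) :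
    ∃ v : moderate U R hR, ∀ᶠ j in (U : Filter ℕ), u.1 j * v.1 j = 1 := by
  have h1 : u - 1 ∈ negligible U R hR := by
    rw [← Ideal.Quotient.eq, hu, map_one]
  -- Negligibility with exponent `1` gives distance at most `1 / R j ≤ 1 / 2` from `1`.
  have h2 : ∀ᶠ j in (U : Filter ℕ), 1 / 2 ≤ ‖u.1 j‖ := by
    filter_upwards [h1 1] with j hj
    have h3 : (u - 1).1 j = u.1 j - 1 := rfl
    rw [h3, pow_one] at hj
    have h4 : ‖(1 : ℂ)‖ - ‖u.1 j‖ ≤ ‖u.1 j - 1‖ := by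
      rw [norm_sub_rev]; exact norm_sub_norm_le _ _
    rw [norm_one] at h4
    have h5 := norm_nonneg (u.1 j - 1)
    nlinarith [hR j]
  refine ⟨⟨fun j => (u.1 j)⁻¹, 1, ?_⟩, ?_⟩
  · filter_upwards [h2] with j hj
    rw [norm_inv, pow_one]
    refine le_trans ?_ (hR j)
    rw [inv_le_comm₀ (by linarith) two_pos]
    linarith
  · filter_upwards [h2] with j hj
    have h0 : u.1 j ≠ 0 := by
      intro h
      rw [h, norm_zero] at hj
      norm_num at hj
    exact mul_inv_cancel₀ h0

/-- The Jordan decomposition over the residue field is lifted entrywise. The identity for `B` may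
hold only modulo negligible sequences, but the lifted conjugation must be genuinely invertible along
`U`. -/
theorem exists_moderate_jordan {n : ℕ} (B : Matrix (Fin n) (Fin n) (moderate U R hR)) :
    ∃ (l : ℕ) (s : Fin l → ℕ) (h : ∑ k, s k = n) (z : Fin l → moderate U R hR)
      (P Q : Matrix (Fin n) (Fin n) (moderate U R hR)),
      (∀ᶠ j in (U : Filter ℕ), P.map (evalAt U R hR j) * Q.map (evalAt U R hR j) = 1) ∧
      ∀ i i', (B - P * jordanMatrix s h z * Q) i i' ∈ negligible U R hR := by
  let π := Ideal.Quotient.mk (negligible U R hR)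
  obtain ⟨l, s, h, z', P', Q', hPQ, hB⟩ := exists_jordanMatrix_similar (B.map π)
  have hlift : ∀ M : Matrix (Fin n) (Fin n) (Residue U R hR),
      ∃ M' : Matrix (Fin n) (Fin n) (moderate U R hR), M'.map π = M := by
    intro M
    choose f hf using fun i i' => Ideal.Quotient.mk_surjective (M i i')
    exact ⟨Matrix.of f, by ext i i'; exact hf i i'⟩
  choose z hz using fun k => Ideal.Quotient.mk_surjective (z' k)
  obtain ⟨P, rfl⟩ := hlift P'
  obtain ⟨Q₀, rfl⟩ := hlift Q'
  have hu : π (P.det * Q₀.det) = 1 := by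
    rw [map_mul, RingHom.map_det, RingHom.map_det, ← Matrix.det_mul]
    exact (congrArg Matrix.det hPQ).trans Matrix.det_one
  obtain ⟨v, hv⟩ := exists_eventual_inverse U R hR _ hu
  -- Arbitrary lifts `P`, `Q₀` are inverse only modulo negligible sequences. Since `v` inverts
  -- `P.det * Q₀.det` along `U`, this `Q` is an exact inverse there, and by uniqueness of inverses
  -- it has the same residue as `Q₀`.
  let Q := (v * Q₀.det) • P.adjugate
  have hPQ' : P * Q = (P.det * Q₀.det * v) • (1 : Matrix (Fin n) (Fin n) (moderate U R hR)) := by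
    rw [Matrix.mul_smul, Matrix.mul_adjugate, smul_smul]
    congr 1
    ring
  have hπv : π (P.det * Q₀.det * v) = 1 := by
    rw [← map_one π]
    apply Ideal.Quotient.eq.mpr
    apply mem_negligible_of_eventually_eq_zero
    filter_upwards [hv] with j hj
    exact sub_eq_zero.mpr hj
  have hQ : Q.map π = Q₀.map π := by
    have h1 : P.map π * Q.map π = 1 := by
      rw [← Matrix.map_mul, hPQ', map_smul_one, hπv, one_smul]
    exact (left_inv_eq_right_inv (mul_eq_one_comm.mp h1) hPQ)
  refine ⟨l, s, h, z, P, Q, ?_, fun i i' => ?_⟩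
  · filter_upwards [hv] with j hj
    have hj' : evalAt U R hR j (P.det * Q₀.det * v) = 1 := hj
    rw [← Matrix.map_mul, hPQ', map_smul_one, hj', one_smul]
  · rw [← Ideal.Quotient.eq_zero_iff_mem]
    have h1 : (B - P * jordanMatrix s h z * Q).map π = 0 := by
      rw [Matrix.map_sub _ (map_sub π), Matrix.map_mul, Matrix.map_mul, jordanMatrix_map, hQ, hB]
      simp only [π, hz, sub_self]
    exact congrFun (congrFun h1 i) i'

end Residue

/-! ### Uniform approximate Jordan forms for complex matrices. -/

/-- **Quantitative Jordan normal form**: up to an error that is small compared to the conjugation,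
every matrix is conjugated to its Jordan normal form with a controlled conjugation. -/
theorem exists_quantitative_jordan (n m : ℕ) : ∃ T : ℕ, ∀ R : ℝ, 2 ≤ R →
    ∀ B : Matrix (Fin n) (Fin n) ℂ, (∀ i j, ‖B i j‖ ≤ R) →
    ∃ (k : ℕ) (P : GL (Fin n) ℂ) (J : Matrix (Fin n) (Fin n) ℂ), 1 ≤ k ∧ k ≤ T ∧
      IsJordanNormalForm J ∧ ‖P.val‖ ≤ R ^ k ∧ ‖(P⁻¹).val‖ ≤ R ^ k ∧
      ‖B - P.val * J * (P⁻¹).val‖ * (R ^ k) ^ m ≤ 1 := by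
  by_contra! hcon
  -- The `j`-th pair `R j`, `B j` is a counterexample to the bound `T = j`, so it excludes every
  -- exponent `k ≤ j`.
  choose R hR B hB hbad using hcon
  let U : Ultrafilter ℕ := hyperfilter ℕ
  let B' : Matrix (Fin n) (Fin n) (moderate U R hR) :=
    fun i i' => ⟨fun j => B j i i', 1, Eventually.of_forall fun j => by simpa using hB j i i'⟩
  obtain ⟨l, s, h, z, P, Q, hPQ, hE⟩ := exists_moderate_jordan U R hR B'
  obtain ⟨k₁, hk₁⟩ := eventually_norm_le_of_moderate U R hR P
  obtain ⟨k₂, hk₂⟩ := eventually_norm_le_of_moderate U R hR Q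
  let k := max k₁ k₂ + 1
  have hE' := eventually_norm_le_of_negligible U R hR _ hE (k * m)
  have hlarge : ∀ᶠ j in (U : Filter ℕ), k ≤ j :=
    (eventually_ge_atTop k).filter_mono (Nat.hyperfilter_le_atTop)
  obtain ⟨j, hj, hPQ, hP, hQ, hE⟩ := (hlarge.and (hPQ.and (hk₁.and (hk₂.and hE')))).exists
  let PG : GL (Fin n) ℂ := ⟨_, _, hPQ, mul_eq_one_comm.mp hPQ⟩
  have hone : 1 ≤ R j := by linarith [hR j]
  refine (hbad j k PG (jordanMatrix s h fun i => evalAt U R hR j (z i)) (by omega) hj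
    (isJordanNormalForm_jordanMatrix _ _ _) (hP.trans (pow_le_pow_right₀ hone (by omega)))
    (hQ.trans (pow_le_pow_right₀ hone (by omega)))).not_ge ?_
  rw [← pow_mul]
  refine le_trans (le_of_eq ?_) hE
  rw [Matrix.map_sub _ (map_sub _), Matrix.map_mul, Matrix.map_mul, jordanMatrix_map]
  rfl

end QPCocycle

/-! ### Calculus of `C^r` norms on the torus. -/

namespace QPCocycle

open Filter Topology

section CrNorm

variable {d : ℕ} {E G : Type*} [NormedAddCommGroup E] [NormedSpace ℝ E] [NormedAddCommGroup G]
  [NormedSpace ℝ G]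

/-- `ℤ^d`-periodic smooth functions on `ℝ^d`. -/
def SmoothPeriodic (f : (Fin d → ℝ) → E) : Prop :=
  ContDiff ℝ ((⊤ : ℕ∞) : WithTop ℕ∞) f ∧
    ∀ (k : Fin d → ℤ) (x : Fin d → ℝ), f (x + fun i => (k i : ℝ)) = f x

theorem proj_add (x y : Fin d → ℝ) : proj (x + y) = proj x + proj y := by
  ext i
  simp [proj]

theorem proj_add_int (x : Fin d → ℝ) (k : Fin d → ℤ) :
    proj (x + fun i => (k i : ℝ)) = proj x := by
  funext i
  simp only [proj, Pi.add_apply, AddCircle.coe_add, add_eq_left]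
  exact (AddCircle.coe_eq_zero_iff 1).mpr ⟨k i, by simp⟩

theorem exists_proj_eq (θ : UnitAddTorus (Fin d)) : ∃ x, proj x = θ := by
  choose x hx using fun i => QuotientAddGroup.mk_surjective (θ i)
  exact ⟨x, funext hx⟩

theorem Smooth.smoothPeriodic {f : UnitAddTorus (Fin d) → E} (hf : Smooth f) :
    SmoothPeriodic (lift f) :=
  ⟨hf, fun k x => congrArg f (proj_add_int x k)⟩

theorem SmoothPeriodic.partialDeriv {f : (Fin d → ℝ) → E} (hf : SmoothPeriodic f) (i : Fin d) :
    SmoothPeriodic (partialDeriv i f) := by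
  refine ⟨?_, fun k x => ?_⟩
  · exact (hf.1.fderiv_right (by simp)).clm_apply contDiff_const
  · have h := fderiv_comp_add_right (𝕜 := ℝ) (f := f) (x := x) (fun i => (k i : ℝ))
    rw [show (fun x => f (x + fun i => (k i : ℝ))) = f from funext (hf.2 k)] at h
    rw [QPCocycle.partialDeriv, QPCocycle.partialDeriv, h]

theorem SmoothPeriodic.bounded {f : (Fin d → ℝ) → E} (hf : SmoothPeriodic f) :
    ∃ C, ∀ x, ‖f x‖ ≤ C := by
  obtain ⟨C, hC⟩ := (isCompact_Icc (a := (0 : Fin d → ℝ)) (b := 1)).exists_bound_of_continuousOn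
    hf.1.continuous.continuousOn
  refine ⟨C, fun x => ?_⟩
  rw [← hf.2 (fun i => -⌊x i⌋) x]
  refine hC _ ⟨fun i => ?_, fun i => ?_⟩
  · simpa using Int.floor_le (x i)
  · have := Int.lt_floor_add_one (x i)
    simp only [Pi.add_apply, Pi.one_apply]
    push_cast
    linarith

/-- A relation preserved by all partial derivatives is preserved by all `∂^α`. -/
theorem multiDeriv_induction {p : ((Fin d → ℝ) → E) → ((Fin d → ℝ) → G) → Prop}
    (hp : ∀ i f g, p f g → p (partialDeriv i f) (partialDeriv i g)) (α : Fin d → ℕ)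
    {f : (Fin d → ℝ) → E} {g : (Fin d → ℝ) → G} (hfg : p f g) :
    p (multiDeriv α f) (multiDeriv α g) := by
  have hit : ∀ i m f g, p f g → p ((partialDeriv i)^[m] f) ((partialDeriv i)^[m] g) := by
    intro i m
    induction m with
    | zero => exact fun f g h => h
    | succ m ih => exact fun f g h => ih _ _ (hp i f g h)
  unfold multiDeriv
  induction List.finRange d with
  | nil => exact hfg
  | cons i l ih => exact hit i _ _ _ ih

theorem SmoothPeriodic.multiDeriv {f : (Fin d → ℝ) → E} (hf : SmoothPeriodic f)
    (α : Fin d → ℕ) : SmoothPeriodic (multiDeriv α f) :=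
  multiDeriv_induction (p := fun f (_ : (Fin d → ℝ) → E) => SmoothPeriodic f)
    (fun i _ _ h => h.partialDeriv i) α (g := f) hf

theorem multiDeriv_clm_comp (L : E →L[ℝ] G) {f : (Fin d → ℝ) → E} (hf : SmoothPeriodic f)
    (α : Fin d → ℕ) : multiDeriv α (fun x => L (f x)) = fun x => L (multiDeriv α f x) := by
  refine (multiDeriv_induction (p := fun f g => SmoothPeriodic f ∧ g = fun x => L (f x))
    ?_ α ⟨hf, rfl⟩).2
  rintro i f g ⟨hf, rfl⟩
  refine ⟨hf.partialDeriv i, ?_⟩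
  ext x
  have h := (L.hasFDerivAt.comp x (hf.1.differentiable (by simp) x).hasFDerivAt).fderiv
  exact congrArg (fun M => M (Pi.single i 1)) h

/-- The first derivative taken replaces the constant by `0`; leaving `c'` existential makes the
claim stable under differentiation. -/
theorem multiDeriv_add_const (f : (Fin d → ℝ) → E) (c : E) (α : Fin d → ℕ) :
    ∃ c' : E, ‖c'‖ ≤ ‖c‖ ∧ multiDeriv α (fun x => f x + c) = fun x => multiDeriv α f x + c' := by
  refine multiDeriv_induction
    (p := fun f g => ∃ c' : E, ‖c'‖ ≤ ‖c‖ ∧ g = fun x => f x + c') ?_ α ⟨c, le_rfl, rfl⟩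
  rintro i f g ⟨c', -, rfl⟩
  refine ⟨0, by simp, ?_⟩
  ext x
  simp [partialDeriv, fderiv_add_const]

theorem multiDeriv_zero (f : (Fin d → ℝ) → E) : multiDeriv 0 f = f := by
  unfold multiDeriv
  induction List.finRange d with
  | nil => rfl
  | cons i l ih => exact ih

theorem multiDeriv_single (i : Fin d) (f : (Fin d → ℝ) → E) :
    multiDeriv (Pi.single i 1) f = partialDeriv i f := by
  have key : ∀ l : List (Fin d), l.Nodup →
      l.foldr (fun j g => (partialDeriv j)^[(Pi.single i 1 : Fin d → ℕ) j] g) f =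
        if i ∈ l then partialDeriv i f else f := by
    intro l hl
    induction l with
    | nil => simp
    | cons j l ih =>
      rw [List.nodup_cons] at hl
      rw [List.foldr_cons, ih hl.2]
      by_cases hij : j = i
      · subst hij
        simp [hl.1]
      · simp [hij, Ne.symm hij]
  simpa [multiDeriv] using key _ (List.nodup_finRange d)

theorem crNorm_nonneg (r : ℕ) (f : UnitAddTorus (Fin d) → E) : 0 ≤ crNorm r f := by
  refine Real.sSup_nonneg ?_
  rintro _ ⟨α, -, x, rfl⟩
  exact norm_nonneg _

theorem crNorm_le {r : ℕ} {f : UnitAddTorus (Fin d) → E} {C : ℝ} (hC : 0 ≤ C)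
    (h : ∀ α : Fin d → ℕ, ∑ i, α i ≤ r → ∀ x, ‖multiDeriv α (lift f) x‖ ≤ C) :
    crNorm r f ≤ C := by
  refine Real.sSup_le ?_ hC
  rintro _ ⟨α, hα, x, rfl⟩
  exact h α hα x

/-- A real `sSup` dominates its set only when the set is bounded. Here finitely many multi-indices
occur, and each derivative is bounded by periodicity. -/
theorem norm_multiDeriv_le_crNorm {f : UnitAddTorus (Fin d) → E} (hf : Smooth f) {r : ℕ}
    {α : Fin d → ℕ} (hα : ∑ i, α i ≤ r) (x : Fin d → ℝ) :
    ‖multiDeriv α (lift f) x‖ ≤ crNorm r f := by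
  refine le_csSup ?_ ⟨α, hα, x, rfl⟩
  choose C hC using fun α : Fin d → ℕ => (hf.smoothPeriodic.multiDeriv α).bounded
  have hfin : {α : Fin d → ℕ | ∑ i, α i ≤ r}.Finite := by
    refine (Set.finite_Iic (fun _ => r : Fin d → ℕ)).subset fun α hα i => ?_
    exact (Finset.single_le_sum (fun _ _ => Nat.zero_le _) (Finset.mem_univ i)).trans hα
  obtain ⟨M, hM⟩ := (hfin.image C).bddAbove
  refine ⟨M, ?_⟩
  rintro _ ⟨α, hα, x, rfl⟩
  exact (hC α x).trans (hM ⟨α, hα, rfl⟩)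

theorem norm_le_crNorm {f : UnitAddTorus (Fin d) → E} (hf : Smooth f) (r : ℕ)
    (θ : UnitAddTorus (Fin d)) : ‖f θ‖ ≤ crNorm r f := by
  obtain ⟨x, rfl⟩ := exists_proj_eq θ
  have h := norm_multiDeriv_le_crNorm hf (r := r) (α := 0) (by simp) x
  rwa [multiDeriv_zero] at h

theorem crNorm_mono {f : UnitAddTorus (Fin d) → E} (hf : Smooth f) {r s : ℕ} (h : r ≤ s) :
    crNorm r f ≤ crNorm s f :=
  crNorm_le (crNorm_nonneg _ _) fun _ hα x => norm_multiDeriv_le_crNorm hf (hα.trans h) x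

theorem Smooth.clm_comp {f : UnitAddTorus (Fin d) → E} (hf : Smooth f) (L : E →L[ℝ] G) :
    Smooth (fun θ => L (f θ)) :=
  L.contDiff.comp hf

theorem Smooth.add_const {f : UnitAddTorus (Fin d) → E} (hf : Smooth f) (c : E) :
    Smooth (fun θ => f θ + c) :=
  ContDiff.add hf contDiff_const

theorem crNorm_clm_comp_le {f : UnitAddTorus (Fin d) → E} (hf : Smooth f) (L : E →L[ℝ] G)
    {C : ℝ} (hL : ‖L‖ ≤ C) (r : ℕ) : crNorm r (fun θ => L (f θ)) ≤ C * crNorm r f := by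
  have hC : 0 ≤ C := (norm_nonneg _).trans hL
  refine crNorm_le (mul_nonneg hC (crNorm_nonneg _ _)) fun α hα x => ?_
  have h := multiDeriv_clm_comp L hf.smoothPeriodic α
  rw [show lift (fun θ => L (f θ)) = fun x => L (lift f x) from rfl, h]
  exact L.le_of_opNorm_le_of_le hL (norm_multiDeriv_le_crNorm hf hα x)

theorem crNorm_add_const_le {f : UnitAddTorus (Fin d) → E} (hf : Smooth f) (c : E) (r : ℕ) :
    crNorm r (fun θ => f θ + c) ≤ crNorm r f + ‖c‖ := by
  refine crNorm_le (add_nonneg (crNorm_nonneg _ _) (norm_nonneg _)) fun α hα x => ?_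
  obtain ⟨c', hc', h⟩ := multiDeriv_add_const (lift f) c α
  rw [show lift (fun θ => f θ + c) = fun x => lift f x + c from rfl, h]
  exact (norm_add_le _ _).trans (add_le_add (norm_multiDeriv_le_crNorm hf hα x) hc')

theorem Smooth.hasDerivAt {f : UnitAddTorus (Fin d) → E} (hf : Smooth f) (ω x : Fin d → ℝ) :
    HasDerivAt (fun t : ℝ => f (proj x + proj (t • ω))) (fderiv ℝ (lift f) x ω) 0 := by
  have h1 : HasDerivAt (fun t : ℝ => x + t • ω) ω 0 := by
    simpa using ((hasDerivAt_id (0 : ℝ)).smul_const ω).const_add x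
  have h2 : HasFDerivAt (lift f) (fderiv ℝ (lift f) x) (x + (0 : ℝ) • ω) := by
    rw [zero_smul, add_zero]
    exact (ContDiff.differentiable hf (by simp) x).hasFDerivAt
  have h3 := h2.comp_hasDerivAt (0 : ℝ) h1
  refine h3.congr_of_eventuallyEq (Eventually.of_forall fun t => ?_)
  simp [lift, proj_add]

theorem norm_dirDeriv_le {f : UnitAddTorus (Fin d) → E} (hf : Smooth f) (ω : Fin d → ℝ)
    (θ : UnitAddTorus (Fin d)) : ‖dirDeriv ω f θ‖ ≤ (∑ i, |ω i|) * crNorm 1 f := by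
  obtain ⟨x, rfl⟩ := exists_proj_eq θ
  rw [dirDeriv, (hf.hasDerivAt ω x).deriv]
  conv_lhs => rw [pi_eq_sum_univ' ω, map_sum]
  rw [Finset.sum_mul]
  refine (norm_sum_le _ _).trans (Finset.sum_le_sum fun i _ => ?_)
  have h := norm_multiDeriv_le_crNorm hf (r := 1) (α := Pi.single i 1) (by simp) x
  rw [multiDeriv_single, partialDeriv] at h
  rw [map_smul, norm_smul, Real.norm_eq_abs]
  have h2 : (fun j => if i = j then (1 : ℝ) else 0) = Pi.single i 1 := by
    ext j
    simp [Pi.single_apply, eq_comm]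
  exact mul_le_mul_of_nonneg_left (by simpa [h2] using h) (abs_nonneg _)

theorem dirDeriv_clm_comp {f : UnitAddTorus (Fin d) → E} (hf : Smooth f) (L : E →L[ℝ] G)
    (ω : Fin d → ℝ) (θ : UnitAddTorus (Fin d)) :
    dirDeriv ω (fun θ => L (f θ)) θ = L (dirDeriv ω f θ) := by
  obtain ⟨x, rfl⟩ := exists_proj_eq θ
  have h := hf.hasDerivAt ω x
  rw [dirDeriv, dirDeriv, h.deriv]
  exact (L.hasFDerivAt.comp_hasDerivAt (0 : ℝ) h).deriv

end CrNorm

/-- Inversion in a Banach algebra is smooth at units. -/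
theorem smooth_inv {d n : ℕ} {Z : UnitAddTorus (Fin d) → GL (Fin n) ℂ}
    (hZ : Smooth (fun θ => (Z θ).val)) : Smooth (fun θ => ((Z θ)⁻¹).val) := by
  have h : lift (fun θ => ((Z θ)⁻¹).val) = fun x => Ring.inverse (lift (fun θ => (Z θ).val) x) := by
    ext1 x
    exact (Ring.inverse_unit _).symm
  rw [Smooth, h, contDiff_iff_contDiffAt]
  intro x
  exact (contDiffAt_ringInverse ℝ (Z (proj x))).comp x (ContDiff.contDiffAt hZ)

theorem norm_entry_le_l2_opNorm {n : ℕ} (M : Matrix (Fin n) (Fin n) ℂ) (i j : Fin n) :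
    ‖M i j‖ ≤ ‖M‖ := by
  have h1 := Matrix.l2_opNorm_mulVec M (EuclideanSpace.single j (1 : ℂ))
  rw [PiLp.norm_single, norm_one, mul_one] at h1
  refine le_trans ?_ h1
  refine le_trans (le_of_eq ?_) (PiLp.norm_apply_le _ i)
  simp

end QPCocycle

/-! ### Diagonal choice of parameters and the new reduction. -/

namespace QPCocycle

open Filter Topology

/-- Diagonal extraction: properties that each hold eventually hold along a sequence of indices
tending to infinity. -/
theorem exists_tendsto_atTop_eventually {Q : ℕ → ℕ → Prop} (hQ : ∀ m, ∀ᶠ j in atTop, Q m j) :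
    ∃ μ : ℕ → ℕ, Tendsto μ atTop atTop ∧ ∀ᶠ j in atTop, Q (μ j) j := by
  classical
  choose N hN using fun m => eventually_atTop.mp (hQ m)
  let p : ℕ → ℕ → Prop := fun j m => ∀ i ≤ m, N i ≤ j
  -- The largest `m ≤ j` such that `j` has passed all thresholds `N 0, …, N m`. The default value
  -- `0` is harmless once `N 0 ≤ j`.
  refine ⟨fun j => Nat.findGreatest (p j) j, tendsto_atTop.mpr fun M => ?_, ?_⟩
  · have h1 : ∀ᶠ j in atTop, ∀ i ∈ Finset.range (M + 1), N i ≤ j :=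
      (Finset.eventually_all _).mpr fun i _ => eventually_ge_atTop (N i)
    filter_upwards [h1, eventually_ge_atTop M] with j h1 h2
    exact Nat.le_findGreatest h2 fun i hi => h1 i (Finset.mem_range.mpr (by omega))
  · filter_upwards [eventually_ge_atTop (N 0)] with j hj
    have h0 : p j 0 := fun i hi => by
      obtain rfl : i = 0 := by omega
      exact hj
    exact hN _ j (Nat.findGreatest_spec (Nat.zero_le j) h0 _ le_rfl)

/-- Almost reducibility controls powers of the two norms separately, so mixed products are traded
for pure powers. -/
theorem one_add_max_pow_le {a b : ℝ} (ha : 0 ≤ a) (hb : 0 ≤ b) (m : ℕ) :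
    ((1 + a) * (1 + b)) ^ m ≤ 4 ^ m * (1 + a ^ (2 * m) + b ^ (2 * m)) := by
  have h1 : ((1 + a) * (1 + b)) ≤ 4 * (max 1 (max a b)) ^ 2 := by
    have h1 := le_max_left 1 (max a b)
    have h2 := (le_max_left a b).trans (le_max_right 1 _)
    have h3 := (le_max_right a b).trans (le_max_right 1 _)
    nlinarith
  have h2 : ((1 + a) * (1 + b)) ^ m ≤ 4 ^ m * (max 1 (max a b)) ^ (2 * m) := by
    rw [pow_mul, ← mul_pow]
    exact pow_le_pow_left₀ (by positivity) h1 m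
  refine h2.trans (mul_le_mul_of_nonneg_left ?_ (by positivity))
  have ha' : 0 ≤ a ^ (2 * m) := by positivity
  have hb' : 0 ≤ b ^ (2 * m) := by positivity
  rcases max_choice 1 (max a b) with h | h
  · rw [h, one_pow]
    linarith
  · rw [h]
    rcases max_choice a b with h | h <;> rw [h] <;> linarith

/-- The matrices `B j` carry no a priori bound; solving the conjugation equation for `B` supplies
one. -/
theorem norm_le_of_conjugation {n : ℕ} {W A D B F : Matrix (Fin n) (Fin n) ℂ} {Z : GL (Fin n) ℂ}
    (hZ : Z.val = W) (h : D = A * W - W * (B + F)) :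
    ‖B‖ ≤ ‖(Z⁻¹).val‖ * (‖A‖ * ‖W‖ + ‖D‖) + ‖F‖ := by
  subst hZ
  have h1 : B = (Z⁻¹).val * (A * Z.val - D) - F := by
    rw [h, sub_sub_cancel, ← mul_assoc, Units.inv_mul, one_mul, add_sub_cancel_right]
  conv_lhs => rw [h1]
  refine (norm_sub_le _ _).trans (add_le_add_left ((norm_mul_le _ _).trans ?_) _)
  refine mul_le_mul_of_nonneg_left ?_ (norm_nonneg _)
  exact (norm_sub_le _ _).trans (add_le_add_left (norm_mul_le _ _) _)

/-- Powers of the size of all data of an almost reduction are beaten by the remainder. -/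
theorem tendsto_size_pow_mul {a b f : ℕ → ℕ → ℝ} {β : ℕ → ℝ} {c : ℝ} (hc : 0 ≤ c)
    (ha : ∀ r j, 0 ≤ a r j) (hb : ∀ r j, 0 ≤ b r j) (hf : ∀ r j, 0 ≤ f r j) (hβ₀ : ∀ j, 0 ≤ β j)
    (hamono : ∀ j, Monotone fun r => a r j) (hbmono : ∀ j, Monotone fun r => b r j)
    (hfmono : ∀ j, Monotone fun r => f r j)
    (hβ : ∀ j, β j ≤ c * (a 1 j * b 1 j) + f 1 j)
    (hlim : ∀ r m : ℕ, Tendsto (fun j => a r j ^ m * f r j) atTop (𝓝 0) ∧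
      Tendsto (fun j => b r j ^ m * f r j) atTop (𝓝 0)) (r m : ℕ) :
    Tendsto (fun j => (2 + a r j + b r j + β j) ^ m * f r j) atTop (𝓝 0) := by
  have hf0 : ∀ r, Tendsto (fun j => f r j) atTop (𝓝 0) := fun r => by simpa using (hlim r 0).1
  -- The index `r + 1` dominates both `r` and the index `1` occurring in `hβ`.
  have hupper : Tendsto (fun j => (3 + c) ^ m * 4 ^ m *
      (f (r + 1) j + a (r + 1) j ^ (2 * m) * f (r + 1) j + b (r + 1) j ^ (2 * m) * f (r + 1) j))
      atTop (𝓝 0) := by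
    have := (((hf0 (r + 1)).add (hlim (r + 1) (2 * m)).1).add (hlim (r + 1) (2 * m)).2).const_mul
      ((3 + c) ^ m * 4 ^ m)
    simpa using this
  have hev : ∀ᶠ j in atTop, f 1 j ≤ 1 :=
    ((hf0 1).eventually (ge_mem_nhds (show (0 : ℝ) < 1 by norm_num)))
  refine squeeze_zero' (Eventually.of_forall fun j => ?_) ?_ hupper
  · have := ha r j
    have := hb r j
    have := hf r j
    have := hβ₀ j
    positivity
  · filter_upwards [hev] with j hj
    have h1 := ha (r + 1) j
    have h2 := hb (r + 1) j
    have h3 := hf (r + 1) j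
    have a1 : a r j ≤ a (r + 1) j := hamono j (by omega)
    have b1 : b r j ≤ b (r + 1) j := hbmono j (by omega)
    have f1 : f r j ≤ f (r + 1) j := hfmono j (by omega)
    have a2 : a 1 j ≤ a (r + 1) j := hamono j (by omega)
    have b2 : b 1 j ≤ b (r + 1) j := hbmono j (by omega)
    have hab : a 1 j * b 1 j ≤ a (r + 1) j * b (r + 1) j := mul_le_mul a2 b2 (hb _ _) h1
    have hsize : 2 + a r j + b r j + β j ≤ (3 + c) * ((1 + a (r + 1) j) * (1 + b (r + 1) j)) := by
      have := mul_le_mul_of_nonneg_left hab hc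
      have := mul_nonneg h1 h2
      have := mul_nonneg hc h1
      have := mul_nonneg hc h2
      nlinarith [hβ j]
    have hnn : 0 ≤ 2 + a r j + b r j + β j := by
      have := ha r j
      have := hb r j
      have := hβ₀ j
      positivity
    calc (2 + a r j + b r j + β j) ^ m * f r j
        ≤ ((3 + c) * ((1 + a (r + 1) j) * (1 + b (r + 1) j))) ^ m * f (r + 1) j := by
          refine mul_le_mul (pow_le_pow_left₀ hnn hsize m) f1 (hf r j) ?_
          positivity
      _ ≤ (3 + c) ^ m * (4 ^ m * (1 + a (r + 1) j ^ (2 * m) + b (r + 1) j ^ (2 * m))) *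
          f (r + 1) j := by
          rw [mul_pow]
          refine mul_le_mul_of_nonneg_right (mul_le_mul_of_nonneg_left ?_ (by positivity)) h3
          exact one_add_max_pow_le h1 h2 m
      _ = _ := by ring

/-- If `x` is at most `K` and `y K ^ μ` stays bounded with `μ → ∞`, `K ≥ 2`, then `y` beats all
powers of `x`. -/
theorem tendsto_pow_mul_of_le {x y K : ℕ → ℝ} {μ : ℕ → ℕ} (hμ : Tendsto μ atTop atTop)
    (hx₀ : ∀ j, 0 ≤ x j) (hy₀ : ∀ j, 0 ≤ y j) (hK : ∀ j, 2 ≤ K j) {C : ℝ} {c : ℕ}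
    (hx : ∀ᶠ j in atTop, x j ≤ K j ^ c) (hy : ∀ᶠ j in atTop, y j * K j ^ μ j ≤ C * K j ^ c)
    (m : ℕ) : Tendsto (fun j => x j ^ m * y j) atTop (𝓝 0) := by
  -- The factor `x j ^ m` costs `K j ^ (c * m)` and the bound on `y j` costs `K j ^ c`; what remains
  -- of `K j ^ μ j` is at least a power of `2`.
  have hlim : Tendsto (fun j => C * (1 / 2 : ℝ) ^ (μ j - (c * m + c))) atTop (𝓝 0) := by
    have h1 := (tendsto_pow_atTop_nhds_zero_of_lt_one (r := (1 / 2 : ℝ)) (by norm_num)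
      (by norm_num)).comp ((tendsto_sub_atTop_nat (c * m + c)).comp hμ)
    simpa using h1.const_mul C
  refine squeeze_zero' (Eventually.of_forall fun j => mul_nonneg (pow_nonneg (hx₀ j) m) (hy₀ j))
    ?_ hlim
  filter_upwards [hx, hy, hμ.eventually_ge_atTop (c * m + c)] with j h1 h2 h3
  have hKpos : 0 < K j := by linarith [hK j]
  have hC : 0 ≤ C := by
    have h4 : 0 ≤ C * K j ^ c := (mul_nonneg (hy₀ j) (by positivity)).trans h2
    exact nonneg_of_mul_nonneg_left h4 (by positivity)
  obtain ⟨e, he⟩ := Nat.exists_eq_add_of_le h3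
  rw [he, Nat.add_sub_cancel_left]
  have h5 : x j ^ m * y j * K j ^ e ≤ C := by
    have h6 : x j ^ m ≤ K j ^ (c * m) := by
      rw [pow_mul]
      exact pow_le_pow_left₀ (hx₀ j) h1 m
    have h7 : (x j ^ m * y j * K j ^ e) * K j ^ (c * m + c) ≤ C * K j ^ (c * m + c) := by
      calc (x j ^ m * y j * K j ^ e) * K j ^ (c * m + c) = x j ^ m * (y j * K j ^ μ j) := by
            rw [he]; ring
        _ ≤ K j ^ (c * m) * (C * K j ^ c) :=
            mul_le_mul h6 h2 (mul_nonneg (hy₀ j) (by positivity)) (by positivity)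
        _ = _ := by ring
    exact le_of_mul_le_mul_right h7 (by positivity)
  have h8 : (2 : ℝ) ^ e ≤ K j ^ e := pow_le_pow_left₀ (by norm_num) (hK j) e
  have hxy : 0 ≤ x j ^ m * y j := mul_nonneg (pow_nonneg (hx₀ j) m) (hy₀ j)
  rw [one_div, inv_pow, ← div_eq_mul_inv, le_div_iff₀ (by positivity)]
  exact (mul_le_mul_of_nonneg_left h8 hxy).trans h5

/-- An almost reducible cocycle is almost reducible to matrices in Jordan normal form; no
arithmetic condition on `ω` is needed. -/
theorem AlmostReducible.exists_jordan {d n : ℕ} (ω : Fin d → ℝ)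
    (A : UnitAddTorus (Fin d) → Matrix (Fin n) (Fin n) ℂ)
    (hA : Smooth A)
    (hred : AlmostReducible ω A) :
    ∃ B : ℕ → Matrix (Fin n) (Fin n) ℂ,
      (∀ j, IsJordanNormalForm (B j)) ∧
      AlmostReducibleTo ω A B := by
  obtain ⟨B, Z, F, hZ, hF, heq, hlim⟩ := hred
  have hZi : ∀ j, Smooth (fun θ => ((Z j θ)⁻¹).val) := fun j => smooth_inv (hZ j)
  let a : ℕ → ℕ → ℝ := fun r j => crNorm r (fun θ => (Z j θ).val)
  let b : ℕ → ℕ → ℝ := fun r j => crNorm r (fun θ => ((Z j θ)⁻¹).val)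
  let f : ℕ → ℕ → ℝ := fun r j => crNorm r (F j)
  have ha : ∀ r j, 0 ≤ a r j := fun _ _ => crNorm_nonneg _ _
  have hb : ∀ r j, 0 ≤ b r j := fun _ _ => crNorm_nonneg _ _
  have hf : ∀ r j, 0 ≤ f r j := fun _ _ => crNorm_nonneg _ _
  have hamono : ∀ j, Monotone fun r => a r j := fun j _ _ h => crNorm_mono (hZ j) h
  have hbmono : ∀ j, Monotone fun r => b r j := fun j _ _ h => crNorm_mono (hZi j) h
  have hfmono : ∀ j, Monotone fun r => f r j := fun j _ _ h => crNorm_mono (hF j) h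
  have hc : 0 ≤ crNorm 1 A + ∑ i, |ω i| :=
    add_nonneg (crNorm_nonneg _ _) (Finset.sum_nonneg fun _ _ => abs_nonneg _)
  have hβ : ∀ j, ‖B j‖ ≤ (crNorm 1 A + ∑ i, |ω i|) * (a 1 j * b 1 j) + f 1 j := by
    intro j
    have h1 := norm_le_of_conjugation rfl (heq j 0)
    have h2 : ‖((Z j 0)⁻¹).val‖ ≤ b 1 j := norm_le_crNorm (hZi j) 1 0
    have h3 : ‖A 0‖ ≤ crNorm 1 A := norm_le_crNorm hA 1 0
    have h4 : ‖(Z j 0).val‖ ≤ a 1 j := norm_le_crNorm (hZ j) 1 0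
    have h5 := norm_dirDeriv_le (hZ j) ω 0
    have h6 : ‖F j 0‖ ≤ f 1 j := norm_le_crNorm (hF j) 1 0
    have h7 := mul_le_mul h3 h4 (norm_nonneg _) (crNorm_nonneg _ _)
    have h8 := mul_le_mul h2 (add_le_add h7 h5)
      (add_nonneg (mul_nonneg (norm_nonneg _) (norm_nonneg _)) (norm_nonneg _)) (hb 1 j)
    refine (h1.trans (add_le_add h8 h6)).trans (le_of_eq ?_)
    simp only [a]
    ring
  let S : ℕ → ℕ → ℝ := fun r j => 2 + a r j + b r j + ‖B j‖
  have hS : ∀ r m, Tendsto (fun j => S r j ^ m * f r j) atTop (𝓝 0) :=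
    tendsto_size_pow_mul hc ha hb hf (fun j => norm_nonneg _) hamono hbmono hfmono hβ hlim
  have hS2 : ∀ r j, 2 ≤ S r j := fun r j => by
    have := ha r j
    have := hb r j
    have := norm_nonneg (B j)
    simp only [S]
    linarith
  choose T hT using exists_quantitative_jordan n
  -- `μ j` serves both as regularity index and as exponent `m`. The power `T m * m` is chosen
  -- because the conjugation will have size `S ^ k` with `k ≤ T m`, so that `F j` too is beaten down
  -- by `(S ^ k) ^ m`.
  obtain ⟨μ, hμ, hdiag⟩ := exists_tendsto_atTop_eventually
    (Q := fun m j => S m j ^ (T m * m) * f m j ≤ 1) fun m =>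
      (hS m (T m * m)).eventually (ge_mem_nhds (show (0 : ℝ) < 1 by norm_num))
  have hBentry : ∀ j i i', ‖B j i i'‖ ≤ S (μ j) j := fun j i i' => by
    have := norm_entry_le_l2_opNorm (B j) i i'
    have := ha (μ j) j
    have := hb (μ j) j
    simp only [S]
    linarith
  choose k P J hk1 hkT hJ hP hPi hE using fun j => hT (μ j) (S (μ j) j) (hS2 _ _) (B j) (hBentry j)
  let K : ℕ → ℝ := fun j => S (μ j) j ^ k j
  have hSK : ∀ j, S (μ j) j ≤ K j := fun j =>
    le_self_pow₀ (by linarith [hS2 (μ j) j]) (by have := hk1 j; omega)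
  have hK : ∀ j, 2 ≤ K j := fun j => (hS2 _ _).trans (hSK j)
  let E : ℕ → Matrix (Fin n) (Fin n) ℂ := fun j => B j - (P j).val * J j * ((P j)⁻¹).val
  let F' : ℕ → UnitAddTorus (Fin d) → Matrix (Fin n) (Fin n) ℂ :=
    fun j θ => ((P j)⁻¹).val * (F j θ + E j) * (P j).val
  let rightMul : Matrix (Fin n) (Fin n) ℂ →
      Matrix (Fin n) (Fin n) ℂ →L[ℝ] Matrix (Fin n) (Fin n) ℂ :=
    fun M => (ContinuousLinearMap.mul ℝ (Matrix (Fin n) (Fin n) ℂ)).flip M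
  have hright : ∀ M, ‖rightMul M‖ ≤ ‖M‖ := fun M =>
    ContinuousLinearMap.opNorm_le_bound _ (norm_nonneg _) fun N =>
      (norm_mul_le N M).trans_eq (mul_comm _ _)
  have hleft : ∀ M, ‖ContinuousLinearMap.mul ℝ (Matrix (Fin n) (Fin n) ℂ) M‖ ≤ ‖M‖ := fun M =>
    ContinuousLinearMap.opNorm_mul_apply_le _ _ _
  have hconj : ∀ j, ‖(ContinuousLinearMap.mulLeftRight ℝ (Matrix (Fin n) (Fin n) ℂ)
      ((P j)⁻¹).val (P j).val)‖ ≤ K j ^ 2 := fun j => by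
    refine (ContinuousLinearMap.opNorm_mulLeftRight_apply_apply_le _ _ _ _).trans ?_
    rw [pow_two]
    exact mul_le_mul (hPi j) (hP j) (norm_nonneg _) (by linarith [hK j])
  have hF'r : ∀ r j, crNorm r (F' j) ≤ K j ^ 2 * (f r j + ‖E j‖) := fun r j =>
    (crNorm_clm_comp_le ((hF j).add_const (E j)) _ (hconj j) r).trans
      (mul_le_mul_of_nonneg_left (crNorm_add_const_le (hF j) _ _) (by have := hK j; positivity))
  -- Once `r ≤ μ j`, both `F j` and `E j` are at most `K j ^ (-μ j)` in norm; conjugation by `P j`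
  -- costs only `K j ^ 2`.
  have hF'lim : ∀ r, ∀ᶠ j in atTop, crNorm r (F' j) * K j ^ μ j ≤ 2 * K j ^ 2 := by
    intro r
    filter_upwards [hdiag, hμ.eventually_ge_atTop r] with j h1 h2
    have hK0 : 0 ≤ K j := by linarith [hK j]
    have h3 : f (μ j) j * K j ^ μ j ≤ 1 := by
      rw [mul_comm]
      refine le_trans (mul_le_mul_of_nonneg_right ?_ (hf _ _)) h1
      rw [← pow_mul]
      exact pow_le_pow_right₀ (by linarith [hS2 (μ j) j]) (Nat.mul_le_mul_right _ (hkT j))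
    have h4 : ‖E j‖ * K j ^ μ j ≤ 1 := hE j
    have h5 : crNorm r (F' j) ≤ K j ^ 2 * (f (μ j) j + ‖E j‖) :=
      (hF'r r j).trans (mul_le_mul_of_nonneg_left (by linarith [hfmono j h2]) (by positivity))
    calc crNorm r (F' j) * K j ^ μ j ≤ K j ^ 2 * (f (μ j) j + ‖E j‖) * K j ^ μ j :=
          mul_le_mul_of_nonneg_right h5 (by positivity)
      _ = K j ^ 2 * (f (μ j) j * K j ^ μ j + ‖E j‖ * K j ^ μ j) := by ring
      _ ≤ K j ^ 2 * (1 + 1) := mul_le_mul_of_nonneg_left (add_le_add h3 h4) (by positivity)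
      _ = 2 * K j ^ 2 := by ring
  refine ⟨J, hJ, fun j θ => Z j θ * P j, F', fun j => (hZ j).clm_comp (rightMul (P j).val),
    fun j => ((hF j).add_const (E j)).clm_comp (ContinuousLinearMap.mulLeftRight ℝ _ _ _),
    fun j θ => ?_, fun r m => ⟨?_, ?_⟩⟩
  · have h1 := dirDeriv_clm_comp (hZ j) (rightMul (P j).val) ω θ
    rw [heq] at h1
    refine h1.trans ?_
    have h2 : (P j).val * ((P j)⁻¹).val = 1 := (P j).mul_inv
    -- `E j` is exactly the defect that turns `P J P⁻¹` back into `B j`.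
    have h3 : (P j).val * (J j + F' j θ) = (B j + F j θ) * (P j).val := by
      have h4 : (P j).val * F' j θ = (F j θ + E j) * (P j).val := by
        simp only [F', ← mul_assoc, h2, one_mul]
      have h5 : ((P j)⁻¹).val * (P j).val = 1 := (P j).inv_mul
      rw [mul_add, h4, add_mul, add_mul]
      simp only [E, sub_mul]
      rw [mul_assoc _ _ (P j).val, h5, mul_one]
      abel
    change (A θ * (Z j θ).val - (Z j θ).val * (B j + F j θ)) * (P j).val =
      A θ * ((Z j θ).val * (P j).val) - ((Z j θ).val * (P j).val) * (J j + F' j θ)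
    rw [sub_mul, mul_assoc, mul_assoc, mul_assoc, h3]
  · refine tendsto_pow_mul_of_le (C := 2) (c := 2) hμ (fun j => crNorm_nonneg _ _)
      (fun j => crNorm_nonneg _ _) hK ?_ (hF'lim r) m
    filter_upwards [hμ.eventually_ge_atTop r] with j hj
    have h1 := crNorm_clm_comp_le (hZ j) (rightMul (P j).val) ((hright _).trans (hP j)) r
    refine h1.trans ?_
    rw [pow_two]
    refine mul_le_mul_of_nonneg_left ?_ (by linarith [hK j])
    have h2 : a r j ≤ a (μ j) j := hamono j hj
    have h3 := hSK j
    have := hb (μ j) j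
    have := norm_nonneg (B j)
    simp only [S] at h3
    change a r j ≤ _
    linarith
  · refine tendsto_pow_mul_of_le (C := 2) (c := 2) hμ (fun j => crNorm_nonneg _ _)
      (fun j => crNorm_nonneg _ _) hK ?_ (hF'lim r) m
    filter_upwards [hμ.eventually_ge_atTop r] with j hj
    have h0 : (fun θ => ((Z j θ * P j)⁻¹).val) = fun θ =>
        ContinuousLinearMap.mul ℝ (Matrix (Fin n) (Fin n) ℂ) ((P j)⁻¹).val ((Z j θ)⁻¹).val := by
      ext1 θ
      rw [mul_inv_rev]
      rfl
    have h1 := crNorm_clm_comp_le (hZi j) (ContinuousLinearMap.mul ℝ (Matrix (Fin n) (Fin n) ℂ)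
      ((P j)⁻¹).val) ((hleft _).trans (hPi j)) r
    rw [h0]
    refine h1.trans ?_
    rw [pow_two]
    refine mul_le_mul_of_nonneg_left ?_ (by linarith [hK j])
    have h2 : b r j ≤ b (μ j) j := hbmono j hj
    have h3 := hSK j
    have := ha (μ j) j
    have := norm_nonneg (B j)
    simp only [S] at h3
    change b r j ≤ _
    linarith

end QPCocycle

theorem mainTheorem4 {d n : ℕ} (ω : Fin d → ℝ)
    (A : UnitAddTorus (Fin d) → Matrix (Fin n) (Fin n) ℂ)
    (hA : QPCocycle.Smooth A)
    (hω : QPCocycle.Diophantine ω)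
    (hred : QPCocycle.AlmostReducible ω A) :
    ∃ B : ℕ → Matrix (Fin n) (Fin n) ℂ,
      (∀ j, QPCocycle.IsJordanNormalForm (B j)) ∧
      QPCocycle.AlmostReducibleTo ω A B :=
  QPCocycle.AlmostReducible.exists_jordan ω A hA hred
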